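/- **Notation.** For $n\ge 1$ let $\mathrm{Cliff}_n(\mathbb R)$ be the associative unital real algebra generated by $i_1,\dots,i_{n-1}$ subject only to $i_hi_k=-i_ki_h$ ($h\ne k$) and $i_h^2=-1$. Let $\alpha\mapsto\alpha^*$ be the linear anti-automorphism that reverses the order of the factors in each product of generators. Let $\mathbb V^n(\mathbb R)$ and $\mathbb V^n(\mathbb Z)$ be the real, respectively integral, linear combinations of $1,i_1,\dots,i_{n-1}$, and let $\Gamma_n(\mathbb R)$ be the group of all finite products of invertible elements of $\mathbb V^n(\mathbb R)$. Let $\mathrm{SL}_+(\Gamma_n(\mathbb R))$ be the set of matrices $\begin{pmatrix}\alpha&\beta\\\gamma&\delta\end{pmatrix}$ with entries in $\Gamma_n(\mathbb R)\cup\{0\}$, with $\alpha\delta^*-\beta\gamma^*=1$ and with $\alpha\beta^*,\gamma\delta^*,\gamma^*\alpha,\delta^*\beta\in\mathbb V^n(\mathbb R)$. Regard $\mathrm{Cliff}_3(\mathbb R)\subset\mathrm{Cliff}_4(\mathbb R)$ as the subalgebra generated by $i_1,i_2$, and let $\mathrm{Cliff}_3(\mathbb Z)=\mathbb Z+\mathbb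 Zi_1+\mathbb Zi_2+\mathbb Zi_1i_2$. Put $\varepsilon_1=\frac12(1+i_1i_2i_3)$ and $\varepsilon_2=\frac12(1-i_1i_2i_3)$; every $\alpha\in\mathrm{Cliff}_4(\mathbb R)$ is uniquely $\varepsilon_1a_1+\varepsilon_2a_2$ with $a_1,a_2\in\mathrm{Cliff}_3(\mathbb R)$. Let $$\tilde\Gamma_4(\mathbb Z)=\{\varepsilon_1a+\varepsilon_2b\mid a,b\in\mathrm{Cliff}_3(\mathbb Z),\ \varepsilon_1a+\varepsilon_2b\in\Gamma_4(\mathbb R)\},$$ and let $\mathrm{SL}_+(\tilde\Gamma_4(\mathbb Z))$ be the set of matrices $\begin{pmatrix}\alpha&\beta\\\gamma&\delta\end{pmatrix}$ with entries in $\tilde\Gamma_4(\mathbb Z)\cup\{0\}$, with $\alpha\delta^*-\beta\gamma^*=1$ and with $\alpha\beta^*,\gamma\delta^*,\gamma^*\alpha,\delta^*\beta\in\mathbb V^4(\mathbb Z)$. Let $\mathbb H(\mathbb R)$ be the Hamilton quaternions and $\mathbb H(\mathbb Z)=\mathbb Z+\mathbb Zi+\mathbb Zj+\mathbb Zk$.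 For $M=\begin{pmatrix}a&b\\c&d\end{pmatrix}\in M_2(\mathbb H(\mathbb R))$ let $$\sigma=\begin{cases}cac^{-1}d-cb & c\ne0,\\ bdb^{-1}a & c=0\neq b,\\ (d-a)a(d-a)^{-1}d & b=c=0,\ a\ne d,\\ a\overline a & b=c=0,\ a=d,\end{cases}$$ and let $\Delta(M)=|\sigma|$ be the Dieudonné determinant. Let $\mathrm{SL}_2(\mathbb H(\mathbb R))$ and $\mathrm{SL}_2(\mathbb H(\mathbb Z))$ be the sets of $2\times2$ matrices with $\Delta=1$ and entries in $\mathbb H(\mathbb R)$, respectively $\mathbb H(\mathbb Z)$. Let $\omega:\mathrm{Cliff}_3(\mathbb R)\to\mathbb H(\mathbb R)$ be the algebra isomorphism with $\omega(i_1)=i$ and $\omega(i_2)=j$, let $\chi_1:\mathrm{Cliff}_4(\mathbb R)\to\mathbb H(\mathbb R)$ be the algebra homomorphism $\varepsilon_1a_1+\varepsilon_2a_2\mapsto\omega(a_1)$, and let $\tilde\chi:M_2(\mathrm{Cliff}_4(\mathbb R))\to M_2(\mathbb H(\mathbb R))$ be $\chi_1$ applied to each entry. **Lemma.** The four sets $\mathrm{SL}_+(\tilde\Gamma_4(\mathbb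 Z))\subseteq\mathrm{SL}_+(\Gamma_4(\mathbb R))$ and $\mathrm{SL}_2(\mathbb H(\mathbb Z))\subseteq\mathrm{SL}_2(\mathbb H(\mathbb R))$ are groups under matrix multiplication, $\tilde\chi$ restricts to a group isomorphism $\chi:\mathrm{SL}_+(\Gamma_4(\mathbb R))\to\mathrm{SL}_2(\mathbb H(\mathbb R))$, and $\chi$ restricts to a group isomorphism from $\mathrm{SL}_+(\tilde\Gamma_4(\mathbb Z))$ onto $\mathrm{SL}_2(\mathbb H(\mathbb Z))$. -/

import Mathlib

open scoped Quaternion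

noncomputable section

namespace CliffordSL

/-! ### The Clifford algebras, with `n - 1` anticommuting generators of square `-1` -/

/-- The negative definite form `v ↦ - ∑ vₕ²` on `ℝ^(n-1)`. -/
def cliffForm (n : ℕ) : QuadraticForm ℝ (Fin (n - 1) → ℝ) :=
  QuadraticMap.weightedSumSquares ℝ (fun _ => (-1 : ℝ))

/-- `Cliff_n(ℝ)`. -/
abbrev Cliff (n : ℕ) : Type := CliffordAlgebra (cliffForm n)

/-- The generators `i_1, …, i_{n-1}` (indexed from `0`). -/
def gen (n : ℕ) (h : Fin (n - 1)) : Cliff n :=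
  CliffordAlgebra.ι (cliffForm n) (Pi.single h 1)

lemma cliffForm_apply (n : ℕ) (v : Fin (n - 1) → ℝ) :
    cliffForm n v = - ∑ h, v h * v h := by
  simp [cliffForm, QuadraticMap.weightedSumSquares_apply]

lemma gen_mul_self (n : ℕ) (h : Fin (n - 1)) : gen n h * gen n h = -1 := by
  rw [gen, CliffordAlgebra.ι_sq_scalar, cliffForm_apply]
  simp [Pi.single_apply]

lemma gen_mul_gen (n : ℕ) {h k : Fin (n - 1)} (hk : h ≠ k) :
    gen n h * gen n k = - (gen n k * gen n h) := by
  rw [eq_neg_iff_add_eq_zero, gen, gen, CliffordAlgebra.ι_mul_ι_add_swap, QuadraticMap.polar]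
  simp only [cliffForm_apply, Pi.add_apply]
  have : ∀ x, (Pi.single h (1 : ℝ) : Fin (n - 1) → ℝ) x *
      (Pi.single k (1 : ℝ) : Fin (n - 1) → ℝ) x = 0 := by
    intro x
    rcases eq_or_ne x h with rfl | hx
    · simp [hk]
    · simp [Pi.single_apply, hx]
  have h2 : ∀ x, ((Pi.single h (1 : ℝ) : Fin (n - 1) → ℝ) x +
      (Pi.single k (1 : ℝ) : Fin (n - 1) → ℝ) x) * ((Pi.single h (1 : ℝ) : Fin (n - 1) → ℝ) x +
      (Pi.single k (1 : ℝ) : Fin (n - 1) → ℝ) x) =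
      (Pi.single h (1 : ℝ) : Fin (n - 1) → ℝ) x * (Pi.single h (1 : ℝ) : Fin (n - 1) → ℝ) x +
      (Pi.single k (1 : ℝ) : Fin (n - 1) → ℝ) x * (Pi.single k (1 : ℝ) : Fin (n - 1) → ℝ) x := by
    intro x
    linear_combination 2 * this x
  simp only [h2, Finset.sum_add_distrib]
  simp

/-- The space `𝕍ⁿ(ℝ)` of Clifford vectors `α₀ + α₁ i_1 + ⋯ + α_{n-1} i_{n-1}`. -/
def vectors (n : ℕ) : Submodule ℝ (Cliff n) :=
  Submodule.span ℝ (insert 1 (Set.range (gen n)))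

/-- `𝕍ⁿ(ℤ)`: the Clifford vectors with integral coefficients. -/
def intVectors (n : ℕ) : Submodule ℤ (Cliff n) :=
  Submodule.span ℤ (insert 1 (Set.range (gen n)))

/-- The Clifford group `Γ_n(ℝ)`: all finite products of invertible vectors. -/
def cliffGroup (n : ℕ) : Submonoid (Cliff n) :=
  Submonoid.closure {α | α ∈ vectors n ∧ IsUnit α}

/-- The reversion `α ↦ α*`. -/
abbrev rev {n : ℕ} (α : Cliff n) : Cliff n := CliffordAlgebra.reverse α

/-- `2 × 2` matrices. -/
abbrev M2 (R : Type) : Type := Matrix (Fin 2) (Fin 2) R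

/-- The pseudo-determinant `α δ* - β γ*`. -/
def vahlenDet {n : ℕ} (M : M2 (Cliff n)) : Cliff n :=
  M 0 0 * rev (M 1 1) - M 0 1 * rev (M 1 0)

/-- The set `GL(Γ_n(ℝ))`. -/
def GLGamma (n : ℕ) : Set (M2 (Cliff n)) :=
  {M | (∀ r s, M r s ∈ cliffGroup n ∨ M r s = 0) ∧ vahlenDet M ≠ 0 ∧
    M 0 0 * rev (M 0 1) ∈ vectors n ∧ M 1 0 * rev (M 1 1) ∈ vectors n ∧
    rev (M 1 0) * M 0 0 ∈ vectors n ∧ rev (M 1 1) * M 0 1 ∈ vectors n}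

/-- The set `SL₊(Γ_n(ℝ))`. -/
def SLPlus (n : ℕ) : Set (M2 (Cliff n)) :=
  {M | M ∈ GLGamma n ∧ vahlenDet M = 1}

/-! ### `Cliff_3 ⊆ Cliff_4` and the central idempotents of `Cliff_4` -/

/-- The linear part of the inclusion `Cliff_3(ℝ) ⊆ Cliff_4(ℝ)`. -/
def inclLin : (Fin (3 - 1) → ℝ) →ₗ[ℝ] Cliff 4 :=
  (CliffordAlgebra.ι (cliffForm 4)).comp
    (LinearMap.pi ![LinearMap.proj (0 : Fin 2), LinearMap.proj (1 : Fin 2), 0] :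
      (Fin 2 → ℝ) →ₗ[ℝ] (Fin 3 → ℝ))

/-- The inclusion `Cliff_3(ℝ) → Cliff_4(ℝ)`, with `i_1 ↦ i_1` and `i_2 ↦ i_2`. -/
def incl : Cliff 3 →ₐ[ℝ] Cliff 4 :=
  CliffordAlgebra.lift (cliffForm 3) ⟨inclLin, fun v => by
    rw [inclLin, LinearMap.comp_apply, CliffordAlgebra.ι_sq_scalar]
    congr 1
    rw [cliffForm_apply, cliffForm_apply]
    change -(∑ h : Fin 3, _) = -(∑ h : Fin 2, _)
    simp [Fin.sum_univ_succ]⟩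

lemma incl_gen_zero : incl (gen 3 (0 : Fin 2)) = gen 4 (0 : Fin 3) := by
  rw [gen, incl, CliffordAlgebra.lift_ι_apply]
  change CliffordAlgebra.ι (cliffForm 4) _ = CliffordAlgebra.ι (cliffForm 4) _
  congr 1
  ext h
  change Fin 3 at h
  fin_cases h <;> simp

lemma incl_gen_one : incl (gen 3 (1 : Fin 2)) = gen 4 (1 : Fin 3) := by
  rw [gen, incl, CliffordAlgebra.lift_ι_apply]
  change CliffordAlgebra.ι (cliffForm 4) _ = CliffordAlgebra.ι (cliffForm 4) _
  congr 1
  ext h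
  change Fin 3 at h
  fin_cases h <;> simp

/-- `Cliff_3(ℤ)`: the integral combinations of `1, i_1, i_2, i_1 i_2`. -/
def cliffThreeInt : Submodule ℤ (Cliff 3) :=
  Submodule.span ℤ {1, gen 3 (0 : Fin 2), gen 3 (1 : Fin 2),
    gen 3 (0 : Fin 2) * gen 3 (1 : Fin 2)}

/-- `ε_1 = (1 + i_1 i_2 i_3) / 2`. -/
def eps1 : Cliff 4 :=
  (1 / 2 : ℝ) • (1 + gen 4 (0 : Fin 3) * gen 4 (1 : Fin 3) * gen 4 (2 : Fin 3))

/-- `ε_2 = (1 - i_1 i_2 i_3) / 2`. -/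
def eps2 : Cliff 4 :=
  (1 / 2 : ℝ) • (1 - gen 4 (0 : Fin 3) * gen 4 (1 : Fin 3) * gen 4 (2 : Fin 3))

/-- `Γ̃_4(ℤ)`. -/
def gammaTilde : Set (Cliff 4) :=
  {α | α ∈ cliffGroup 4 ∧
    ∃ a ∈ cliffThreeInt, ∃ b ∈ cliffThreeInt, α = eps1 * incl a + eps2 * incl b}

/-- The set `SL₊(Γ̃_4(ℤ))`; as in `SL₊(Γ_4(ℝ))`, entries are allowed to vanish. -/
def SLPlusTilde : Set (M2 (Cliff 4)) :=
  {M | (∀ r s, M r s ∈ gammaTilde ∨ M r s = 0) ∧ vahlenDet M = 1 ∧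
    M 0 0 * rev (M 0 1) ∈ intVectors 4 ∧ M 1 0 * rev (M 1 1) ∈ intVectors 4 ∧
    rev (M 1 0) * M 0 0 ∈ intVectors 4 ∧ rev (M 1 1) * M 0 1 ∈ intVectors 4}

/-! ### Quaternions and the Dieudonné determinant -/

/-- `ℍ(ℤ)`: the integral combinations of `1, i, j, k` in `ℍ(ℝ)`. -/
def quatInt : Set ℍ[ℝ] :=
  {q | ∃ x y z w : ℤ, q = ⟨(x : ℝ), (y : ℝ), (z : ℝ), (w : ℝ)⟩}

open scoped Classical in
/-- The pseudo-determinant `σ` of a quaternionic `2 × 2` matrix. -/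
def sigma (M : M2 ℍ[ℝ]) : ℍ[ℝ] :=
  if M 1 0 ≠ 0 then M 1 0 * M 0 0 * (M 1 0)⁻¹ * M 1 1 - M 1 0 * M 0 1
  else if M 0 1 ≠ 0 then M 0 1 * M 1 1 * (M 0 1)⁻¹ * M 0 0
  else if M 0 0 ≠ M 1 1 then
    (M 1 1 - M 0 0) * M 0 0 * (M 1 1 - M 0 0)⁻¹ * M 1 1
  else M 0 0 * star (M 0 0)

/-- The Dieudonné determinant `Δ = |σ|`. -/
def dieudonne (M : M2 ℍ[ℝ]) : ℝ := ‖sigma M‖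

/-- `SL_2(ℍ(ℝ))`. -/
def SL2Real : Set (M2 ℍ[ℝ]) := {M | dieudonne M = 1}

/-- `SL_2(ℍ(ℤ))`. -/
def SL2Int : Set (M2 ℍ[ℝ]) := {M | (∀ r s, M r s ∈ quatInt) ∧ dieudonne M = 1}

/-! ### The maps `ω` and `χ_1` -/

/-- The quaternion `x + y i + z j + w k`. -/
def quat (x y z w : ℝ) : ℍ[ℝ] := ⟨x, y, z, w⟩

@[simp] lemma quat_re (x y z w : ℝ) : (quat x y z w).re = x := rfl
@[simp] lemma quat_imI (x y z w : ℝ) : (quat x y z w).imI = y := rfl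
@[simp] lemma quat_imJ (x y z w : ℝ) : (quat x y z w).imJ = z := rfl
@[simp] lemma quat_imK (x y z w : ℝ) : (quat x y z w).imK = w := rfl

/-- `(v_1, v_2) ↦ v_1 i + v_2 j`. -/
def omegaLin : (Fin (3 - 1) → ℝ) →ₗ[ℝ] ℍ[ℝ] where
  toFun v := quat 0 (v (0 : Fin 2)) (v (1 : Fin 2)) 0
  map_add' v w := by ext <;> simp
  map_smul' c v := by ext <;> simp

lemma omegaLin_apply (v : Fin (3 - 1) → ℝ) :
    omegaLin v = quat 0 (v (0 : Fin 2)) (v (1 : Fin 2)) 0 := rfl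

/-- The algebra homomorphism `Cliff_3(ℝ) → ℍ(ℝ)`, `i_1 ↦ i`, `i_2 ↦ j`. -/
def omegaHom : Cliff 3 →ₐ[ℝ] ℍ[ℝ] :=
  CliffordAlgebra.lift (cliffForm 3) ⟨omegaLin, fun v => by
    rw [cliffForm_apply, omegaLin_apply]
    change _ = algebraMap ℝ ℍ[ℝ] (-(∑ h : Fin 2, v h * v h))
    ext <;> simp [Fin.sum_univ_succ] <;> ring⟩

lemma omegaHom_gen_zero : omegaHom (gen 3 (0 : Fin 2)) = quat 0 1 0 0 := by
  rw [gen, omegaHom, CliffordAlgebra.lift_ι_apply, omegaLin_apply]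
  simp

lemma omegaHom_gen_one : omegaHom (gen 3 (1 : Fin 2)) = quat 0 0 1 0 := by
  rw [gen, omegaHom, CliffordAlgebra.lift_ι_apply, omegaLin_apply]
  simp

/-- The elements `i_1, i_2, i_1 i_2` of `Cliff_3(ℝ)` multiply like `i, j, k`. -/
def cliffThreeBasis : QuaternionAlgebra.Basis (Cliff 3) (-1 : ℝ) 0 (-1) where
  i := gen 3 (0 : Fin 2)
  j := gen 3 (1 : Fin 2)
  k := gen 3 (0 : Fin 2) * gen 3 (1 : Fin 2)
  i_mul_i := by simp [gen_mul_self]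
  j_mul_j := by simp [gen_mul_self]
  i_mul_j := rfl
  j_mul_i := by
    rw [gen_mul_gen 3 (h := (1 : Fin 2)) (k := (0 : Fin 2)) (by decide)]; simp

/-- The inverse of `ω`. -/
def omegaInv : ℍ[ℝ] →ₐ[ℝ] Cliff 3 := QuaternionAlgebra.lift cliffThreeBasis

lemma ι_three (v : Fin 2 → ℝ) : CliffordAlgebra.ι (cliffForm 3) v =
    v 0 • gen 3 (0 : Fin 2) + v 1 • gen 3 (1 : Fin 2) := by
  rw [gen, gen, ← map_smul, ← map_smul, ← map_add]
  congr 1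
  ext h
  change Fin 2 at h
  fin_cases h <;> simp

lemma ι_four (v : Fin 3 → ℝ) : CliffordAlgebra.ι (cliffForm 4) v =
    v 0 • gen 4 (0 : Fin 3) + v 1 • gen 4 (1 : Fin 3) + v 2 • gen 4 (2 : Fin 3) := by
  rw [gen, gen, gen, ← map_smul, ← map_smul, ← map_smul, ← map_add, ← map_add]
  congr 1
  ext h
  change Fin 3 at h
  fin_cases h <;> simp

lemma omegaInv_apply (q : ℍ[ℝ]) : omegaInv q = algebraMap ℝ _ q.re + q.imI • gen 3 (0 : Fin 2) +
    q.imJ • gen 3 (1 : Fin 2) + q.imK • (gen 3 (0 : Fin 2) * gen 3 (1 : Fin 2)) := rfl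

/-- The algebra isomorphism `ω : Cliff_3(ℝ) ≃ ℍ(ℝ)` with `i_1 ↦ i`, `i_2 ↦ j` (and hence
`i_1 i_2 ↦ k`). -/
def omega : Cliff 3 ≃ₐ[ℝ] ℍ[ℝ] :=
  AlgEquiv.ofAlgHom omegaHom omegaInv
    (by
      refine AlgHom.ext fun q => ?_
      simp only [AlgHom.comp_apply, omegaInv_apply, map_add, map_smul, map_mul,
        omegaHom_gen_zero, omegaHom_gen_one, AlgHom.commutes]
      ext <;> simp)
    (by
      refine CliffordAlgebra.hom_ext (LinearMap.ext fun v => ?_)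
      change omegaInv (omegaHom (CliffordAlgebra.ι (cliffForm 3) v)) =
        CliffordAlgebra.ι (cliffForm 3) v
      rw [ι_three v]
      simp only [map_add, map_smul, omegaHom_gen_zero, omegaHom_gen_one]
      rw [omegaInv_apply, omegaInv_apply]
      simp)

lemma omega_gen : omega (gen 3 (0 : Fin 2)) = quat 0 1 0 0 ∧
    omega (gen 3 (1 : Fin 2)) = quat 0 0 1 0 ∧
    omega (gen 3 (0 : Fin 2) * gen 3 (1 : Fin 2)) = quat 0 0 0 1 := by
  refine ⟨omegaHom_gen_zero, omegaHom_gen_one, ?_⟩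
  change omegaHom (gen 3 (0 : Fin 2) * gen 3 (1 : Fin 2)) = _
  rw [map_mul, omegaHom_gen_zero, omegaHom_gen_one]
  ext <;> simp

/-- `(v_1, v_2, v_3) ↦ v_1 i + v_2 j - v_3 k`. -/
def chi1Lin : (Fin (4 - 1) → ℝ) →ₗ[ℝ] ℍ[ℝ] where
  toFun v := quat 0 (v (0 : Fin 3)) (v (1 : Fin 3)) (-v (2 : Fin 3))
  map_add' v w := by ext <;> simp; ring
  map_smul' c v := by ext <;> simp

lemma chi1Lin_apply (v : Fin (4 - 1) → ℝ) :
    chi1Lin v = quat 0 (v (0 : Fin 3)) (v (1 : Fin 3)) (-v (2 : Fin 3)) := rfl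

/-- The algebra homomorphism `χ_1 : Cliff_4(ℝ) → ℍ(ℝ)`, given on generators by `i_1 ↦ i`,
`i_2 ↦ j`, `i_3 ↦ -k`. By `chi1_eps` and `existsUnique_eps` below, it is the map
`ε_1 a_1 + ε_2 a_2 ↦ ω a_1`. -/
def chi1 : Cliff 4 →ₐ[ℝ] ℍ[ℝ] :=
  CliffordAlgebra.lift (cliffForm 4) ⟨chi1Lin, fun v => by
    rw [cliffForm_apply, chi1Lin_apply]
    change _ = algebraMap ℝ ℍ[ℝ] (-(∑ h : Fin 3, v h * v h))
    ext <;> simp [Fin.sum_univ_succ] <;> ring⟩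

/-- `(v_1, v_2, v_3) ↦ v_1 i + v_2 j + v_3 k`. -/
def chi2Lin : (Fin (4 - 1) → ℝ) →ₗ[ℝ] ℍ[ℝ] where
  toFun v := quat 0 (v (0 : Fin 3)) (v (1 : Fin 3)) (v (2 : Fin 3))
  map_add' v w := by ext <;> simp
  map_smul' c v := by ext <;> simp

lemma chi2Lin_apply (v : Fin (4 - 1) → ℝ) :
    chi2Lin v = quat 0 (v (0 : Fin 3)) (v (1 : Fin 3)) (v (2 : Fin 3)) := rfl

/-- The companion of `chi1` with `i_3 ↦ k`, used only to prove uniqueness in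
`existsUnique_eps`. -/
def chi2 : Cliff 4 →ₐ[ℝ] ℍ[ℝ] :=
  CliffordAlgebra.lift (cliffForm 4) ⟨chi2Lin, fun v => by
    rw [cliffForm_apply, chi2Lin_apply]
    change _ = algebraMap ℝ ℍ[ℝ] (-(∑ h : Fin 3, v h * v h))
    ext <;> simp [Fin.sum_univ_succ] <;> ring⟩

lemma chi1_gen : chi1 (gen 4 (0 : Fin 3)) = quat 0 1 0 0 ∧
    chi1 (gen 4 (1 : Fin 3)) = quat 0 0 1 0 ∧ chi1 (gen 4 (2 : Fin 3)) = quat 0 0 0 (-1) := by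
  refine ⟨?_, ?_, ?_⟩ <;> rw [gen, chi1, CliffordAlgebra.lift_ι_apply, chi1Lin_apply] <;> simp

lemma chi2_gen : chi2 (gen 4 (0 : Fin 3)) = quat 0 1 0 0 ∧
    chi2 (gen 4 (1 : Fin 3)) = quat 0 0 1 0 ∧ chi2 (gen 4 (2 : Fin 3)) = quat 0 0 0 1 := by
  refine ⟨?_, ?_, ?_⟩ <;> rw [gen, chi2, CliffordAlgebra.lift_ι_apply, chi2Lin_apply] <;> simp

lemma chi1_incl (a : Cliff 3) : chi1 (incl a) = omega a := by
  have : chi1.comp incl = omegaHom := by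
    refine CliffordAlgebra.hom_ext (LinearMap.ext fun v => ?_)
    change chi1 (incl (CliffordAlgebra.ι (cliffForm 3) v)) =
      omegaHom (CliffordAlgebra.ι (cliffForm 3) v)
    rw [ι_three v]
    simp only [map_add, map_smul, incl_gen_zero, incl_gen_one, chi1_gen, omegaHom_gen_zero,
      omegaHom_gen_one]
  exact DFunLike.congr_fun this a

lemma chi2_incl (a : Cliff 3) : chi2 (incl a) = omega a := by
  have : chi2.comp incl = omegaHom := by
    refine CliffordAlgebra.hom_ext (LinearMap.ext fun v => ?_)
    change chi2 (incl (CliffordAlgebra.ι (cliffForm 3) v)) =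
      omegaHom (CliffordAlgebra.ι (cliffForm 3) v)
    rw [ι_three v]
    simp only [map_add, map_smul, incl_gen_zero, incl_gen_one, chi2_gen, omegaHom_gen_zero,
      omegaHom_gen_one]
  exact DFunLike.congr_fun this a

lemma chi1_eps (a b : Cliff 3) : chi1 (eps1 * incl a + eps2 * incl b) = omega a := by
  have h1 : chi1 eps1 = 1 := by
    simp only [eps1, map_smul, map_add, map_mul, map_one, chi1_gen]
    ext <;> simp; norm_num
  have h2 : chi1 eps2 = 0 := by
    simp only [eps2, map_smul, map_sub, map_mul, map_one, chi1_gen]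
    ext <;> simp
  rw [map_add, map_mul, map_mul, h1, h2, chi1_incl]; simp

lemma chi2_eps (a b : Cliff 3) : chi2 (eps1 * incl a + eps2 * incl b) = omega b := by
  have h1 : chi2 eps1 = 0 := by
    simp only [eps1, map_smul, map_add, map_mul, map_one, chi2_gen]
    ext <;> simp
  have h2 : chi2 eps2 = 1 := by
    simp only [eps2, map_smul, map_sub, map_mul, map_one, chi2_gen]
    ext <;> simp; norm_num
  rw [map_add, map_mul, map_mul, h1, h2, chi2_incl b]; simp

lemma gen_relations :
    (gen 4 (1 : Fin 3) * gen 4 (0 : Fin 3) = -(gen 4 (0 : Fin 3) * gen 4 (1 : Fin 3))) ∧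
    (gen 4 (2 : Fin 3) * gen 4 (0 : Fin 3) = -(gen 4 (0 : Fin 3) * gen 4 (2 : Fin 3))) ∧
    (gen 4 (2 : Fin 3) * gen 4 (1 : Fin 3) = -(gen 4 (1 : Fin 3) * gen 4 (2 : Fin 3))) :=
  ⟨gen_mul_gen 4 (h := (1 : Fin 3)) (k := (0 : Fin 3)) (by decide),
    gen_mul_gen 4 (h := (2 : Fin 3)) (k := (0 : Fin 3)) (by decide),
    gen_mul_gen 4 (h := (2 : Fin 3)) (k := (1 : Fin 3)) (by decide)⟩

/-- Computations with three anticommuting square roots of `-1`. -/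
lemma omega_relations {A : Type} [Ring A] {x y z : A} (hx : x * x = -1) (hy : y * y = -1)
    (hz : z * z = -1) (hyx : y * x = -(x * y)) (hzx : z * x = -(x * z))
    (hzy : z * y = -(y * z)) :
    Commute (x * y * z) x ∧ Commute (x * y * z) y ∧ Commute (x * y * z) z ∧
      (x * y * z) * (x * y * z) = 1 ∧ z = -((x * y * z) * (x * y)) := by
  have hx' : ∀ t, x * (x * t) = -t := fun t => by rw [← mul_assoc, hx]; simp
  have hy' : ∀ t, y * (y * t) = -t := fun t => by rw [← mul_assoc, hy]; simp
  have hyx' : ∀ t, y * (x * t) = -(x * (y * t)) := fun t => by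
    rw [← mul_assoc, hyx]; simp [mul_assoc]
  have hzx' : ∀ t, z * (x * t) = -(x * (z * t)) := fun t => by
    rw [← mul_assoc, hzx]; simp [mul_assoc]
  have hzy' : ∀ t, z * (y * t) = -(y * (z * t)) := fun t => by
    rw [← mul_assoc, hzy]; simp [mul_assoc]
  refine ⟨?_, ?_, ?_, ?_, ?_⟩ <;>
    simp [Commute, SemiconjBy, mul_assoc, hx, hy, hz, hx', hy', hzx, hzy, hyx', hzx', hzy']

/-- `i_1 i_2 i_3` is central in `Cliff_4(ℝ)`. -/
lemma commute_triple (α : Cliff 4) :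
    Commute (gen 4 (0 : Fin 3) * gen 4 (1 : Fin 3) * gen 4 (2 : Fin 3)) α := by
  obtain ⟨h0, h1, h2, -, -⟩ := omega_relations (gen_mul_self 4 (0 : Fin 3))
    (gen_mul_self 4 (1 : Fin 3)) (gen_mul_self 4 (2 : Fin 3)) gen_relations.1
    gen_relations.2.1 gen_relations.2.2
  induction α using CliffordAlgebra.induction with
  | algebraMap r => exact (Algebra.commutes r _).symm
  | ι v =>
    rw [ι_four v]
    exact ((h0.smul_right _).add_right (h1.smul_right _)).add_right (h2.smul_right _)
  | mul a b ha hb => exact ha.mul_right hb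
  | add a b ha hb => exact ha.add_right hb

lemma eps_relations : eps1 * eps1 = eps1 ∧ eps2 * eps2 = eps2 ∧ eps1 * eps2 = 0 ∧
    eps2 * eps1 = 0 ∧ eps1 + eps2 = 1 := by
  obtain ⟨-, -, -, hw, -⟩ := omega_relations (gen_mul_self 4 (0 : Fin 3))
    (gen_mul_self 4 (1 : Fin 3)) (gen_mul_self 4 (2 : Fin 3)) gen_relations.1
    gen_relations.2.1 gen_relations.2.2
  unfold eps1 eps2
  generalize gen 4 (0 : Fin 3) * gen 4 (1 : Fin 3) * gen 4 (2 : Fin 3) = w at *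
  refine ⟨?_, ?_, ?_, ?_, ?_⟩
  · rw [smul_mul_smul_comm, add_mul, mul_add, mul_add, hw]; simp only [one_mul, mul_one]; module
  · rw [smul_mul_smul_comm, sub_mul, mul_sub, mul_sub, hw]; simp only [one_mul, mul_one]; module
  · rw [smul_mul_smul_comm, add_mul, mul_sub, mul_sub, hw]; simp only [one_mul, mul_one]; module
  · rw [smul_mul_smul_comm, sub_mul, mul_add, mul_add, hw]; simp only [one_mul, mul_one]; module
  · module

lemma eps_central (α : Cliff 4) : Commute eps1 α ∧ Commute eps2 α :=
  ⟨((Commute.one_left α).add_left (commute_triple α)).smul_left _,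
    ((Commute.one_left α).sub_left (commute_triple α)).smul_left _⟩

lemma exists_eps (α : Cliff 4) : ∃ a b : Cliff 3, α = eps1 * incl a + eps2 * incl b := by
  obtain ⟨h11, h22, h12, h21, hs⟩ := eps_relations
  have hdiag : ∀ a : Cliff 3, incl a = eps1 * incl a + eps2 * incl a := fun a => by
    rw [← add_mul, hs, one_mul]
  induction α using CliffordAlgebra.induction with
  | algebraMap r =>
    exact ⟨algebraMap ℝ _ r, algebraMap ℝ _ r, by rw [← hdiag, AlgHom.commutes]⟩
  | ι v =>
    obtain ⟨-, -, -, -, hz⟩ := omega_relations (gen_mul_self 4 (0 : Fin 3))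
      (gen_mul_self 4 (1 : Fin 3)) (gen_mul_self 4 (2 : Fin 3)) gen_relations.1
      gen_relations.2.1 gen_relations.2.2
    have hz' : gen 4 (2 : Fin 3) =
        eps1 * incl (-(gen 3 (0 : Fin 2) * gen 3 (1 : Fin 2))) +
          eps2 * incl (gen 3 (0 : Fin 2) * gen 3 (1 : Fin 2)) := by
      rw [map_neg, map_mul, incl_gen_zero, incl_gen_one, mul_neg]
      conv_lhs => rw [hz]
      unfold eps1 eps2
      rw [smul_mul_assoc, smul_mul_assoc, add_mul, sub_mul]
      module
    refine ⟨ (v (0 : Fin 3)) • gen 3 (0 : Fin 2) + (v (1 : Fin 3)) • gen 3 (1 : Fin 2) +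
        (v (2 : Fin 3)) • -(gen 3 (0 : Fin 2) * gen 3 (1 : Fin 2)),
      (v (0 : Fin 3)) • gen 3 (0 : Fin 2) + (v (1 : Fin 3)) • gen 3 (1 : Fin 2) +
        (v (2 : Fin 3)) • (gen 3 (0 : Fin 2) * gen 3 (1 : Fin 2)), ?_⟩
    rw [ι_four v, hz', ← incl_gen_zero, ← incl_gen_one]
    conv_lhs => rw [hdiag (gen 3 (0 : Fin 2)), hdiag (gen 3 (1 : Fin 2))]
    simp only [map_add, map_smul, mul_add, mul_smul_comm]
    module
  | mul x y hx hy =>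
    obtain ⟨a, b, rfl⟩ := hx
    obtain ⟨c, d, rfl⟩ := hy
    refine ⟨a * c, b * d, ?_⟩
    have e1 : ∀ p q : Cliff 4, eps1 * p * (eps1 * q) = eps1 * (p * q) := fun p q => by
      rw [mul_assoc, ← mul_assoc p, ← (eps_central p).1.eq, mul_assoc, ← mul_assoc, h11]
    have e2 : ∀ p q : Cliff 4, eps2 * p * (eps2 * q) = eps2 * (p * q) := fun p q => by
      rw [mul_assoc, ← mul_assoc p, ← (eps_central p).2.eq, mul_assoc, ← mul_assoc, h22]
    have e3 : ∀ p q : Cliff 4, eps1 * p * (eps2 * q) = 0 := fun p q => by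
      rw [mul_assoc, ← mul_assoc p, ← (eps_central p).2.eq, mul_assoc, ← mul_assoc, h12, zero_mul]
    have e4 : ∀ p q : Cliff 4, eps2 * p * (eps1 * q) = 0 := fun p q => by
      rw [mul_assoc, ← mul_assoc p, ← (eps_central p).1.eq, mul_assoc, ← mul_assoc, h21, zero_mul]
    rw [add_mul, mul_add, mul_add, e1, e2, e3, e4, map_mul, map_mul]
    simp
  | add x y hx hy =>
    obtain ⟨a, b, rfl⟩ := hx
    obtain ⟨c, d, rfl⟩ := hy
    refine ⟨a + c, b + d, ?_⟩
    rw [map_add, map_add, mul_add, mul_add]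
    abel

/-- Every element of `Cliff_4(ℝ)` is `ε_1 a_1 + ε_2 a_2` for unique `a_1, a_2 ∈ Cliff_3(ℝ)`. -/
lemma existsUnique_eps (α : Cliff 4) :
    ∃! p : Cliff 3 × Cliff 3, α = eps1 * incl p.1 + eps2 * incl p.2 := by
  obtain ⟨a, b, h⟩ := exists_eps α
  refine ⟨(a, b), h, ?_⟩
  rintro ⟨c, d⟩ h'
  have h1 := congrArg chi1 (h.symm.trans h')
  have h2 := congrArg chi2 (h.symm.trans h')
  simp only [chi1_eps, chi2_eps] at h1 h2
  exact Prod.ext (omega.injective h1).symm (omega.injective h2).symm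

/-- The homomorphism `χ̃ : M_2(Cliff_4(ℝ)) → M_2(ℍ(ℝ))`, entrywise `χ_1`. -/
def chiTilde : M2 (Cliff 4) →ₐ[ℝ] M2 ℍ[ℝ] := chi1.mapMatrix

end CliffordSL

end

open scoped Quaternion

noncomputable section

namespace CliffordSL

open Quaternion

/-! ### The square of the Dieudonné determinant as a polynomial -/

/-! The pair (`chi1`, `chi2`) identifies `Cliff 4` with ℍ × ℍ. Since i₁i₂i₃ is reversed to its
negative, reversion exchanges the two factors, up to the anti-automorphism `tau` with k ↦ -k.
Vectors are therefore exactly the fixed points of reversion, that is, the pairs (p, `tau` p).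
Elements of the Clifford group have components of equal norm, and conversely every nonzero pair of
equal norms is a product of vectors, because a unit quaternion is a commutator
(`mem_cliffGroup_four_or_eq_zero`).

A matrix M over `Cliff 4` thus amounts to two quaternionic matrices, Q = `chiTilde` M and N =
`chiTilde (dagger M)`, and the vector and determinant conditions say precisely that QN = 1
(`mul_dagger_eq_one_iff`). So Q determines M, and every invertible Q occurs. What remains is to
match the equal-norm condition on the entries with Δ(Q) = 1.

For this, Δ² is the polynomial `gram`, the Gram determinant (|a|² + |b|²)(|c|² + |d|²) - |a c̄ + b
d̄|² of the rows; it is multiplicative (`gram_mul`). A polynomial adjugate satisfies Q · `quatAdj` Q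
= Δ² · 1, and the squared norms of its entries are Δ² times those of Q, with the diagonal
interchanged (`normSq_quatAdj`). Comparing with N = Q⁻¹, equal norms hold if and only if Δ = 1
(`mem_SLPlus_four`). In that case N = `quatAdj` Q, which is integral whenever Q is; this gives the
integral statement (`mem_SLPlusTilde`). -/

/-- The polynomial `|a|²|d|² + |b|²|c|² - 2 Re (a c̄ d b̄)` in the rows `(a, b)` and `(c, d)`. -/
def gram (a b c d : ℍ[ℝ]) : ℝ :=
  normSq a * normSq d + normSq b * normSq c - 2 * (a * star c * d * star b).re

lemma re_mul_comm (p q : ℍ[ℝ]) : (p * q).re = (q * p).re := by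
  simp only [re_mul]; ring

lemma re_coe_mul (r : ℝ) (q : ℍ[ℝ]) : ((r : ℍ[ℝ]) * q).re = r * q.re := by simp

lemma gram_swap (a b c d : ℍ[ℝ]) : gram c d a b = gram a b c d := by
  have h : (c * star a * b * star d).re = (a * star c * d * star b).re := by
    rw [← re_star]; simp only [star_mul, star_star]
    rw [← mul_assoc, re_mul_comm]; simp only [mul_assoc]
  simp only [gram, h]; ring

lemma gram_smul_right (t a b c d : ℍ[ℝ]) :
    gram a b (t * c) (t * d) = normSq t * gram a b c d := by
  have h : (a * star (t * c) * (t * d) * star b).re = normSq t * (a * star c * d * star b).re := by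
    rw [star_mul, show a * (star c * star t) * (t * d) * star b =
      a * star c * (star t * t) * d * star b by simp only [mul_assoc], star_mul_self,
      ← coe_commutes, mul_assoc, mul_assoc, re_coe_mul]
    simp only [mul_assoc]
  simp only [gram, h, map_mul]; ring

lemma gram_smul_left (t a b c d : ℍ[ℝ]) :
    gram (t * a) (t * b) c d = normSq t * gram a b c d := by
  rw [gram_swap, gram_smul_right, gram_swap]

/-- A Gram determinant does not change when a left multiple of one row is added to the other. Here
it is a polynomial identity in the sixteen coordinates of the entries and the four of `t`. -/
lemma gram_add_right (t a b c d : ℍ[ℝ]) :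
    gram a b (c + t * a) (d + t * b) = gram a b c d := by
  simp only [gram, normSq_def', re_mul, imI_mul, imJ_mul, imK_mul, re_star, imI_star, imJ_star,
    imK_star, re_add, imI_add, imJ_add, imK_add]
  ring

lemma gram_add_left (t a b c d : ℍ[ℝ]) :
    gram (a + t * c) (b + t * d) c d = gram a b c d := by
  rw [gram_swap, gram_add_right, gram_swap]

/-- Row reduction of the left factor shows that the left side is a constant κ, depending only on `a
b c d`, times `gram p q r s`. The identity matrix as right factor then identifies κ. This avoids
expanding the product in coordinates. -/
lemma gram_mul (a b c d p q r s : ℍ[ℝ]) :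
    gram (a * p + b * r) (a * q + b * s) (c * p + d * r) (c * q + d * s) =
      gram a b c d * gram p q r s := by
  obtain ⟨κ, key⟩ : ∃ κ : ℝ, ∀ p q r s : ℍ[ℝ],
      gram (a * p + b * r) (a * q + b * s) (c * p + d * r) (c * q + d * s) =
        κ * gram p q r s := by
    by_cases h : a = 0
    · refine ⟨normSq b * normSq c, fun p q r s => ?_⟩
      subst h
      simp only [zero_mul, zero_add]
      rw [gram_smul_left, gram_add_right, gram_smul_right, gram_swap]
      ring
    · refine ⟨normSq a * normSq (d - c * a⁻¹ * b), fun p q r s => ?_⟩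
      -- Gaussian elimination with pivot `a`: subtracting `c * a⁻¹` times the first row leaves a
      -- left multiple of `(r, s)` as second row.
      have h' : ∀ x y : ℍ[ℝ], c * x + d * y + -(c * a⁻¹) * (a * x + b * y) =
          (d - c * a⁻¹ * b) * y := fun x y => by
        have : c * a⁻¹ * (a * x) = c * x := by rw [← mul_assoc, inv_mul_cancel_right₀ h]
        rw [neg_mul, mul_add, this]; noncomm_ring
      rw [← gram_add_right (-(c * a⁻¹)), h', h', gram_smul_right, gram_add_left, gram_smul_left]
      ring
  have h1 := key 1 0 0 1
  have h2 : gram (1 : ℍ[ℝ]) 0 0 1 = 1 := by simp [gram]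
  simp only [mul_one, mul_zero, add_zero, zero_add, h2] at h1
  rw [key, h1]

/-- The polynomial `gram` of a quaternionic matrix; it is the square of `dieudonne`. -/
def gramDet (M : M2 ℍ[ℝ]) : ℝ := gram (M 0 0) (M 0 1) (M 1 0) (M 1 1)

lemma gramDet_mul (M N : M2 ℍ[ℝ]) : gramDet (M * N) = gramDet M * gramDet N := by
  simp only [gramDet, Matrix.mul_apply, Fin.sum_univ_two, gram_mul]

lemma gramDet_one : gramDet 1 = 1 := by simp [gramDet, gram]

/-- Only the case c ≠ 0 has a cross term: real parts are invariant under cyclic permutation, so the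
outer c meets its conjugate, and the resulting |c|² turns c⁻¹ into c̄. In the other cases b or c
vanishes and norms multiply. -/
lemma normSq_sigma (M : M2 ℍ[ℝ]) : normSq (sigma M) = gramDet M := by
  unfold sigma gramDet gram
  generalize M 0 0 = a, M 0 1 = b, M 1 0 = c, M 1 1 = d
  split_ifs with h1 h2 h3
  · have hc : normSq c ≠ 0 := normSq_ne_zero.2 h1
    have h : (c * a * c⁻¹ * d * star (c * b)).re = (a * star c * d * star b).re := by
      rw [star_mul, ← mul_assoc, re_mul_comm,
        show star c * (c * a * c⁻¹ * d * star b) = (star c * c) * (a * c⁻¹ * d * star b) by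
          simp only [mul_assoc], star_mul_self, re_coe_mul,
        show c⁻¹ = (normSq c)⁻¹ • star c from rfl, mul_smul_comm, smul_mul_assoc, smul_mul_assoc,
        re_smul, smul_eq_mul, mul_inv_cancel_left₀ hc]
    rw [sub_eq_add_neg, normSq_add, normSq_neg, star_neg, mul_neg, re_neg, h]
    simp only [map_mul, normSq_inv]
    field_simp
    ring
  · have hb : normSq b ≠ 0 := normSq_ne_zero.2 h2
    rw [not_not.1 h1]
    simp only [map_mul, normSq_inv, star_zero, mul_zero, zero_mul, re_zero, map_zero]
    field_simp
    ring
  · have hd : normSq (d - a) ≠ 0 := normSq_ne_zero.2 (sub_ne_zero.2 (Ne.symm h3))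
    rw [not_not.1 h1]
    simp only [map_mul, normSq_inv, star_zero, mul_zero, zero_mul, re_zero, map_zero]
    field_simp
    ring
  · rw [not_not.1 h1, not_not.1 h3]
    simp

lemma dieudonne_eq_one_iff (M : M2 ℍ[ℝ]) : dieudonne M = 1 ↔ gramDet M = 1 := by
  rw [dieudonne, ← normSq_sigma, normSq_eq_norm_mul_self, ← sq,
    pow_eq_one_iff_of_nonneg (norm_nonneg _) two_ne_zero]

/-- A quaternionic analogue of the adjugate. -/
def quatAdj (M : M2 ℍ[ℝ]) : M2 ℍ[ℝ] :=
  !![((normSq (M 1 1) : ℝ) : ℍ[ℝ]) * star (M 0 0) - star (M 1 0) * M 1 1 * star (M 0 1),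
    ((normSq (M 0 1) : ℝ) : ℍ[ℝ]) * star (M 1 0) - star (M 0 0) * M 0 1 * star (M 1 1);
    ((normSq (M 1 0) : ℝ) : ℍ[ℝ]) * star (M 0 1) - star (M 1 1) * M 1 0 * star (M 0 0),
    ((normSq (M 0 0) : ℝ) : ℍ[ℝ]) * star (M 1 1) - star (M 0 1) * M 0 0 * star (M 1 0)]

/-- Off the diagonal, the real factors |c|² and |d|² commute past everything and the terms cancel.
On the diagonal, the mixed terms are conjugate to each other and add up to twice a real part. -/
lemma mul_quatAdj (M : M2 ℍ[ℝ]) : M * quatAdj M = gramDet M • 1 := by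
  have off : ∀ a b c d : ℍ[ℝ],
      c * (((normSq d : ℝ) : ℍ[ℝ]) * star a - star c * d * star b) +
        d * (((normSq c : ℝ) : ℍ[ℝ]) * star b - star d * c * star a) = 0 := fun a b c d => by
    have h1 : c * (star c * d * star b) = ((normSq c : ℝ) : ℍ[ℝ]) * (d * star b) := by
      rw [mul_assoc, ← mul_assoc, self_mul_star]
    have h2 : d * (star d * c * star a) = ((normSq d : ℝ) : ℍ[ℝ]) * (c * star a) := by
      rw [mul_assoc, ← mul_assoc, self_mul_star]
    have h3 : c * (((normSq d : ℝ) : ℍ[ℝ]) * star a) = ((normSq d : ℝ) : ℍ[ℝ]) * (c * star a) := by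
      rw [← mul_assoc, ← coe_commutes, mul_assoc]
    have h4 : d * (((normSq c : ℝ) : ℍ[ℝ]) * star b) = ((normSq c : ℝ) : ℍ[ℝ]) * (d * star b) := by
      rw [← mul_assoc, ← coe_commutes, mul_assoc]
    rw [mul_sub, mul_sub, h1, h2, h3, h4]; abel
  have diag : ∀ a b c d : ℍ[ℝ],
      a * (((normSq d : ℝ) : ℍ[ℝ]) * star a - star c * d * star b) +
        b * (((normSq c : ℝ) : ℍ[ℝ]) * star b - star d * c * star a) = ((gram a b c d : ℝ) : ℍ[ℝ]) :=
      fun a b c d => by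
    have h1 : a * (((normSq d : ℝ) : ℍ[ℝ]) * star a) = ((normSq d : ℝ) : ℍ[ℝ]) * ((normSq a : ℝ) : ℍ[ℝ]) := by
      rw [← mul_assoc, ← coe_commutes, mul_assoc, self_mul_star]
    have h2 : b * (((normSq c : ℝ) : ℍ[ℝ]) * star b) = ((normSq c : ℝ) : ℍ[ℝ]) * ((normSq b : ℝ) : ℍ[ℝ]) := by
      rw [← mul_assoc, ← coe_commutes, mul_assoc, self_mul_star]
    have h3 : a * (star c * d * star b) + b * (star d * c * star a) =
        ((2 * (a * star c * d * star b).re : ℝ) : ℍ[ℝ]) := by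
      have := self_add_star (a * star c * d * star b)
      simp only [star_mul, star_star] at this
      rw [coe_mul, show ((2 : ℝ) : ℍ[ℝ]) = 2 from rfl, ← this]
      simp only [mul_assoc]
    rw [mul_sub, mul_sub, h1, h2, gram, coe_sub, ← h3]
    push_cast
    rw [(coe_commute (normSq c) ((normSq b : ℝ) : ℍ[ℝ])).eq,
      (coe_commute (normSq d) ((normSq a : ℝ) : ℍ[ℝ])).eq]
    abel
  have hs : gram (M 1 0) (M 1 1) (M 0 0) (M 0 1) = gramDet M := gram_swap ..
  ext1 r s
  fin_cases r <;> fin_cases s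
  · simpa [Matrix.mul_apply, quatAdj, Algebra.smul_def, gramDet] using diag _ _ _ _
  · simpa [Matrix.mul_apply, quatAdj, Algebra.smul_def, add_comm] using
      off (M 1 0) (M 1 1) (M 0 0) (M 0 1)
  · simpa [Matrix.mul_apply, quatAdj, Algebra.smul_def] using off _ _ _ _
  · simpa [Matrix.mul_apply, quatAdj, Algebra.smul_def, add_comm, hs] using
      diag (M 1 0) (M 1 1) (M 0 0) (M 0 1)

/-- In the expansion of an entry's squared norm all three terms share one factor, such as |d|², and
the cofactor is `gram`. The other entries follow by the symmetry of `gram` under exchange of rows or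
columns. -/
lemma normSq_quatAdj (M : M2 ℍ[ℝ]) :
    normSq (quatAdj M 0 0) = normSq (M 1 1) * gramDet M ∧
    normSq (quatAdj M 0 1) = normSq (M 0 1) * gramDet M ∧
    normSq (quatAdj M 1 0) = normSq (M 1 0) * gramDet M ∧
    normSq (quatAdj M 1 1) = normSq (M 0 0) * gramDet M := by
  have key : ∀ a b c d : ℍ[ℝ], normSq (((normSq d : ℝ) : ℍ[ℝ]) * star a - star c * d * star b) =
      normSq d * gram a b c d := fun a b c d => by
    have h : (((normSq d : ℝ) : ℍ[ℝ]) * star a * star (star c * d * star b)).re =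
        normSq d * (a * star c * d * star b).re := by
      rw [mul_assoc, re_coe_mul, ← re_star]
      simp only [star_mul, star_star]
      rw [re_mul_comm]; simp only [mul_assoc]
    rw [sub_eq_add_neg, normSq_add, normSq_neg, star_neg, mul_neg, re_neg, h, gram]
    simp only [map_mul, normSq_star, normSq_coe]
    ring
  have sw : ∀ a b c d : ℍ[ℝ], gram b a d c = gram a b c d := fun a b c d => by
    have h : (b * star d * c * star a).re = (a * star c * d * star b).re := by
      rw [← re_star]; simp only [star_mul, star_star, mul_assoc]
    simp only [gram, h]; ring
  refine ⟨key (M 0 0) (M 0 1) (M 1 0) (M 1 1), ?_, ?_, ?_⟩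
  · rw [gramDet, ← gram_swap]; exact key (M 1 0) (M 1 1) (M 0 0) (M 0 1)
  · rw [gramDet, ← sw]; exact key (M 0 1) (M 0 0) (M 1 1) (M 1 0)
  · rw [gramDet, ← gram_swap, ← sw]; exact key (M 1 1) (M 1 0) (M 0 1) (M 0 0)

/-! ### Integral quaternions and their adjugates -/

lemma mem_quatInt {q : ℍ[ℝ]} : q ∈ quatInt ↔ ∃ x y z w : ℤ, q = quat x y z w := Iff.rfl

/-- The ring `ℍ(ℤ)` of integral quaternions. -/
def quatIntSubring : Subring ℍ[ℝ] where
  carrier := quatInt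
  zero_mem' := ⟨0, 0, 0, 0, by ext <;> simp⟩
  one_mem' := ⟨1, 0, 0, 0, by ext <;> simp⟩
  add_mem' := by
    simp only [mem_quatInt]
    rintro _ _ ⟨a, b, c, d, rfl⟩ ⟨e, f, g, h, rfl⟩
    exact ⟨a + e, b + f, c + g, d + h, by ext <;> simp⟩
  neg_mem' := by
    simp only [mem_quatInt]
    rintro _ ⟨a, b, c, d, rfl⟩
    exact ⟨-a, -b, -c, -d, by ext <;> simp⟩
  mul_mem' := by
    simp only [mem_quatInt]
    rintro _ _ ⟨a, b, c, d, rfl⟩ ⟨e, f, g, h, rfl⟩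
    exact ⟨a * e - b * f - c * g - d * h, a * f + b * e + c * h - d * g,
      a * g - b * h + c * e + d * f, a * h + b * g - c * f + d * e, by ext <;> simp⟩

lemma mem_quatIntSubring {q : ℍ[ℝ]} :
    q ∈ quatIntSubring ↔ ∃ x y z w : ℤ, q = quat x y z w := Iff.rfl

lemma star_mem_quatIntSubring {q : ℍ[ℝ]} (h : q ∈ quatIntSubring) : star q ∈ quatIntSubring := by
  obtain ⟨a, b, c, d, rfl⟩ := mem_quatIntSubring.1 h
  exact ⟨a, -b, -c, -d, by ext <;> simp⟩

lemma normSq_mem_quatIntSubring {q : ℍ[ℝ]} (h : q ∈ quatIntSubring) :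
    ((normSq q : ℝ) : ℍ[ℝ]) ∈ quatIntSubring := by
  rw [← self_mul_star]
  exact mul_mem h (star_mem_quatIntSubring h)

lemma quatAdj_mem_quatIntSubring {M : M2 ℍ[ℝ]} (h : ∀ r s, M r s ∈ quatIntSubring) (r s : Fin 2) :
    quatAdj M r s ∈ quatIntSubring := by
  have h' := fun r s => star_mem_quatIntSubring (h r s)
  have hn := fun r s => normSq_mem_quatIntSubring (h r s)
  fin_cases r <;> fin_cases s <;>
    exact sub_mem (mul_mem (hn _ _) (h' _ _)) (mul_mem (mul_mem (h' _ _) (h _ _)) (h' _ _))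

/-! ### The reversion `k ↦ -k` of the quaternions -/

/-- The anti-automorphism of `ℍ(ℝ)` that fixes `i` and `j` and sends `k` to `-k`. -/
def tau (q : ℍ[ℝ]) : ℍ[ℝ] := quat q.re q.imI q.imJ (-q.imK)

lemma tau_tau (q : ℍ[ℝ]) : tau (tau q) = q := by ext <;> simp [tau]
lemma tau_mul (p q : ℍ[ℝ]) : tau (p * q) = tau q * tau p := by ext <;> simp [tau] <;> ring
lemma tau_add (p q : ℍ[ℝ]) : tau (p + q) = tau p + tau q := by ext <;> simp [tau]; ring
lemma tau_neg (p : ℍ[ℝ]) : tau (-p) = -tau p := by ext <;> simp [tau]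
lemma tau_one : tau 1 = 1 := by ext <;> simp [tau]
lemma normSq_tau (q : ℍ[ℝ]) : normSq (tau q) = normSq q := by simp [tau, normSq_def']

lemma tau_mem_quatIntSubring {q : ℍ[ℝ]} (h : q ∈ quatIntSubring) : tau q ∈ quatIntSubring := by
  obtain ⟨a, b, c, d, rfl⟩ := mem_quatIntSubring.1 h
  exact ⟨a, b, c, -d, by ext <;> simp [tau]⟩

/-- Every unit quaternion is a commutator. -/
lemma exists_commutator {u : ℍ[ℝ]} (hu : normSq u = 1) :
    ∃ p q : ℍ[ℝ], p ≠ 0 ∧ q ≠ 0 ∧ u * (q * p) = p * q := by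
  by_cases h : u = -1
  · refine ⟨quat 0 1 0 0, quat 0 0 1 0, ?_, ?_, ?_⟩
    · exact fun h => by simpa using congrArg QuaternionAlgebra.imI h
    · exact fun h => by simpa using congrArg QuaternionAlgebra.imJ h
    · rw [h]; ext <;> simp
  -- For a unit u ≠ -1, the quaternion p = u + 1 satisfies p = u p̄. Conjugation by an imaginary q
  -- orthogonal to the imaginary part of u sends p to p̄, so the commutator of p and q is p p̄⁻¹ =
  -- u.
  have hp : u + 1 ≠ 0 := fun h' => h (eq_neg_of_add_eq_zero_left h')
  obtain ⟨q, hq, h0, ho⟩ : ∃ q : ℍ[ℝ], q ≠ 0 ∧ q.re = 0 ∧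
      u.imI * q.imI + u.imJ * q.imJ + u.imK * q.imK = 0 := by
    by_cases h' : u.imI = 0
    · exact ⟨quat 0 1 0 0, fun h => by simpa using congrArg QuaternionAlgebra.imI h, rfl,
        by simp [h']⟩
    · exact ⟨quat 0 (-u.imJ) u.imI 0, fun h => h' (by simpa using congrArg QuaternionAlgebra.imJ h),
        rfl, by simp; ring⟩
  refine ⟨u + 1, q, hp, hq, ?_⟩
  have hc : q * u = star u * q := by
    ext <;> simp [h0] <;> linarith
  rw [mul_add, hc, mul_add, ← mul_assoc, self_mul_star, hu]
  simp only [coe_one, one_mul, mul_one, add_mul]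
  abel

/-! ### `Cliff_4(ℝ)` as the product `ℍ(ℝ) × ℍ(ℝ)` -/

lemma chi_ext {x y : Cliff 4} (h1 : chi1 x = chi1 y) (h2 : chi2 x = chi2 y) : x = y := by
  obtain ⟨a, b, rfl⟩ := exists_eps x
  obtain ⟨c, d, rfl⟩ := exists_eps y
  rw [chi1_eps, chi1_eps] at h1
  rw [chi2_eps, chi2_eps] at h2
  rw [omega.injective h1, omega.injective h2]

/-- The element of `Cliff_4(ℝ)` with given images under `χ_1` and `χ_2`. -/
def ofPair (p q : ℍ[ℝ]) : Cliff 4 := eps1 * incl (omega.symm p) + eps2 * incl (omega.symm q)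

@[simp] lemma chi1_ofPair (p q : ℍ[ℝ]) : chi1 (ofPair p q) = p := by simp [ofPair, chi1_eps]

@[simp] lemma chi2_ofPair (p q : ℍ[ℝ]) : chi2 (ofPair p q) = q := by
  rw [ofPair, chi2_eps, AlgEquiv.apply_symm_apply]

lemma rev_mul {n : ℕ} (a b : Cliff n) : rev (a * b) = rev b * rev a :=
  CliffordAlgebra.reverse.map_mul a b

lemma rev_rev {n : ℕ} (a : Cliff n) : rev (rev a) = a := CliffordAlgebra.reverse_reverse a

lemma rev_one {n : ℕ} : rev (1 : Cliff n) = 1 := CliffordAlgebra.reverse.map_one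

lemma rev_gen {n : ℕ} (h : Fin (n - 1)) : rev (gen n h) = gen n h :=
  CliffordAlgebra.reverse_ι _

/-- Both sides are additive and reverse products, so it suffices to compare them on scalars and
generators, where `tau` absorbs the opposite signs given to i₃. -/
lemma chi2_rev (x : Cliff 4) : chi2 (rev x) = tau (chi1 x) := by
  induction x using CliffordAlgebra.induction with
  | algebraMap r => rw [rev, CliffordAlgebra.reverse.commutes, AlgHom.commutes, AlgHom.commutes]
                    ext <;> simp [tau]
  | ι v =>
    rw [rev, CliffordAlgebra.reverse_ι, chi1, chi2, CliffordAlgebra.lift_ι_apply,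
      CliffordAlgebra.lift_ι_apply, chi1Lin_apply, chi2Lin_apply]
    ext <;> simp [tau]
  | mul a b ha hb => rw [rev_mul, map_mul, map_mul, tau_mul, ha, hb]
  | add a b ha hb => rw [rev, map_add, map_add, map_add, tau_add, ← ha, ← hb]

lemma chi1_rev (x : Cliff 4) : chi1 (rev x) = tau (chi2 x) := by
  rw [← tau_tau (chi1 (rev x)), ← chi2_rev, rev_rev]

/-- The Clifford vector in `𝕍⁴(ℝ)` with image `q` under `χ_1`. -/
def toVector (q : ℍ[ℝ]) : Cliff 4 :=
  q.re • 1 + q.imI • gen 4 (0 : Fin 3) + q.imJ • gen 4 (1 : Fin 3) + (-q.imK) • gen 4 (2 : Fin 3)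

lemma chi1_toVector (q : ℍ[ℝ]) : chi1 (toVector q) = q := by
  simp only [toVector, map_add, map_smul, map_one, chi1_gen]
  ext <;> simp

lemma gen_mem_vectors (n : ℕ) (h : Fin (n - 1)) : gen n h ∈ vectors n :=
  Submodule.subset_span (Set.mem_insert_of_mem _ ⟨h, rfl⟩)

lemma one_mem_vectors (n : ℕ) : 1 ∈ vectors n := Submodule.subset_span (Set.mem_insert _ _)

lemma toVector_mem_vectors (q : ℍ[ℝ]) : toVector q ∈ vectors 4 :=
  add_mem (add_mem (add_mem (Submodule.smul_mem _ _ (one_mem_vectors 4))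
    (Submodule.smul_mem _ _ (gen_mem_vectors 4 (0 : Fin 3))))
    (Submodule.smul_mem _ _ (gen_mem_vectors 4 (1 : Fin 3))))
    (Submodule.smul_mem _ _ (gen_mem_vectors 4 (2 : Fin 3)))

lemma rev_eq_self_of_mem_vectors {n : ℕ} {x : Cliff n} (hx : x ∈ vectors n) : rev x = x := by
  induction hx using Submodule.span_induction with
  | mem x hx =>
    rcases hx with rfl | ⟨h, rfl⟩
    · exact rev_one
    · exact rev_gen h
  | zero => exact map_zero _
  | add x y _ _ hx hy => rw [rev, map_add, ← rev, ← rev, hx, hy]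
  | smul r x _ hx => rw [rev, map_smul, ← rev, hx]

/-- For a fixed point of reversion, the second component is `tau` of the first, so the first
component decides everything. -/
lemma eq_toVector_of_rev_eq_self {x : Cliff 4} (hx : rev x = x) : x = toVector (chi1 x) := by
  refine chi_ext (chi1_toVector _).symm ?_
  rw [← rev_eq_self_of_mem_vectors (toVector_mem_vectors _), chi2_rev, chi1_toVector, ← chi2_rev,
    hx]

lemma mem_vectors_four {x : Cliff 4} : x ∈ vectors 4 ↔ rev x = x :=
  ⟨rev_eq_self_of_mem_vectors,
    fun h => eq_toVector_of_rev_eq_self h ▸ toVector_mem_vectors _⟩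

lemma mem_intVectors_four {x : Cliff 4} :
    x ∈ intVectors 4 ↔ rev x = x ∧ chi1 x ∈ quatIntSubring := by
  constructor
  · intro hx
    refine ⟨mem_vectors_four.1 (Submodule.span_le_restrictScalars ℤ ℝ _ hx), ?_⟩
    induction hx using Submodule.span_induction with
    | mem x hx =>
      rcases hx with rfl | ⟨h, rfl⟩
      · rw [map_one]; exact one_mem _
      · change Fin 3 at h
        rw [mem_quatIntSubring]
        fin_cases h
        · exact ⟨0, 1, 0, 0, by simpa using chi1_gen.1⟩
        · exact ⟨0, 0, 1, 0, by simpa using chi1_gen.2.1⟩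
        · exact ⟨0, 0, 0, -1, by simpa using chi1_gen.2.2⟩
    | zero => rw [map_zero]; exact zero_mem _
    | add x y _ _ hx hy => rw [map_add]; exact add_mem hx hy
    | smul r x _ hx => rw [map_zsmul]; exact zsmul_mem hx r
  · rintro ⟨hx, h⟩
    obtain ⟨a, b, c, d, h⟩ := mem_quatIntSubring.1 h
    have hg : ∀ k, gen 4 k ∈ intVectors 4 := fun k =>
      Submodule.subset_span (Set.mem_insert_of_mem _ ⟨k, rfl⟩)
    have h1 : (1 : Cliff 4) ∈ intVectors 4 := Submodule.subset_span (Set.mem_insert _ _)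
    have hi : ∀ (n : ℤ) (x : Cliff 4), x ∈ intVectors 4 → (n : ℝ) • x ∈ intVectors 4 :=
      fun n x hx => by rw [Int.cast_smul_eq_zsmul]; exact Submodule.smul_mem _ n hx
    rw [eq_toVector_of_rev_eq_self hx, h, toVector]
    refine add_mem (add_mem (add_mem (hi a _ h1) (hi b _ (hg (0 : Fin 3))))
      (hi c _ (hg (1 : Fin 3)))) ?_
    rw [quat_imK, ← Int.cast_neg]
    exact hi _ _ (hg (2 : Fin 3))

/-! ### The Clifford group `Γ_4(ℝ)` -/

/-- The components p and `tau` p of a vector have the same norm, and norms are multiplicative. -/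
lemma normSq_chi1_eq_of_mem_cliffGroup {x : Cliff 4} (hx : x ∈ cliffGroup 4) :
    normSq (chi1 x) = normSq (chi2 x) := by
  induction hx using Submonoid.closure_induction with
  | mem x hx =>
    have h := chi2_rev x
    rw [mem_vectors_four.1 hx.1] at h
    rw [h, normSq_tau]
  | one => simp only [map_one]
  | mul x y _ _ hx hy => simp only [map_mul, hx, hy]

lemma isUnit_of_chi_ne_zero {x : Cliff 4} (h1 : chi1 x ≠ 0) (h2 : chi2 x ≠ 0) : IsUnit x :=
  ⟨⟨x, ofPair (chi1 x)⁻¹ (chi2 x)⁻¹, chi_ext (by simp [h1]) (by simp [h2]),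
    chi_ext (by simp [h1]) (by simp [h2])⟩, rfl⟩

lemma ofPair_tau_mem_cliffGroup {p : ℍ[ℝ]} (hp : p ≠ 0) : ofPair p (tau p) ∈ cliffGroup 4 := by
  have hr : rev (ofPair p (tau p)) = ofPair p (tau p) :=
    chi_ext (by rw [chi1_rev, chi2_ofPair, chi1_ofPair, tau_tau])
      (by rw [chi2_rev, chi2_ofPair, chi1_ofPair])
  refine Submonoid.subset_closure ⟨mem_vectors_four.2 hr, isUnit_of_chi_ne_zero ?_ ?_⟩
  · rwa [chi1_ofPair]
  · rw [chi2_ofPair, ← normSq_ne_zero, normSq_tau, normSq_ne_zero]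
    exact hp

/-- Splitting off the vector (p, `tau` p) leaves (1, u) with |u| = 1. Writing u as a commutator
makes (1, u) a product of three vectors, since `tau` reverses products: a product trivial in the
first component can be a commutator in the second. -/
lemma mem_cliffGroup_four_of_normSq {x : Cliff 4} (h : normSq (chi1 x) = normSq (chi2 x))
    (h0 : chi1 x ≠ 0) : x ∈ cliffGroup 4 := by
  set p := chi1 x with hp
  have ht : ∀ {y : ℍ[ℝ]}, y ≠ 0 → tau y ≠ 0 := fun {y} hy => by
    rwa [← normSq_ne_zero, normSq_tau, normSq_ne_zero]
  have hn : normSq p ≠ 0 := normSq_ne_zero.2 h0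
  obtain ⟨r, s, hr, hs, hrs⟩ := exists_commutator (u := (tau p)⁻¹ * chi2 x) (by
    rw [map_mul, normSq_inv, normSq_tau, ← h, inv_mul_cancel₀ hn])
  have hsr : s * r ≠ 0 := mul_ne_zero hs hr
  -- The last three factors are (`tau` r, r), (`tau` s, s) and ((`tau` r `tau` s)⁻¹, (s r)⁻¹), with
  -- product (1, r s (s r)⁻¹).
  have key : x = ofPair p (tau p) * ofPair (tau r) (tau (tau r)) *
      ofPair (tau s) (tau (tau s)) * ofPair (tau r * tau s)⁻¹ (tau (tau r * tau s)⁻¹) := by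
    have hi : tau (tau r * tau s)⁻¹ = (s * r)⁻¹ := by
      apply eq_inv_of_mul_eq_one_left
      rw [show s * r = tau (tau r * tau s) by rw [tau_mul, tau_tau, tau_tau], ← tau_mul,
        mul_inv_cancel₀ (mul_ne_zero (ht hr) (ht hs)), tau_one]
    refine chi_ext ?_ ?_
    · simp only [map_mul, chi1_ofPair]
      rw [mul_assoc (p : ℍ[ℝ]), mul_assoc, mul_inv_cancel₀ (mul_ne_zero (ht hr) (ht hs)), mul_one]
    · simp only [map_mul, chi2_ofPair, hi, tau_tau]
      rw [mul_assoc (tau p), ← hrs, mul_assoc, mul_assoc _ (s * r), mul_inv_cancel₀ hsr, mul_one,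
        mul_inv_cancel_left₀ (ht h0)]
  rw [key]
  exact mul_mem (mul_mem (mul_mem (ofPair_tau_mem_cliffGroup h0)
    (ofPair_tau_mem_cliffGroup (ht hr))) (ofPair_tau_mem_cliffGroup (ht hs)))
    (ofPair_tau_mem_cliffGroup (inv_ne_zero (mul_ne_zero (ht hr) (ht hs))))

lemma mem_cliffGroup_four_or_eq_zero {x : Cliff 4} :
    x ∈ cliffGroup 4 ∨ x = 0 ↔ normSq (chi1 x) = normSq (chi2 x) := by
  constructor
  · rintro (h | rfl)
    · exact normSq_chi1_eq_of_mem_cliffGroup h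
    · simp
  · intro h
    by_cases h0 : chi1 x = 0
    · refine Or.inr (chi_ext (by rw [h0, map_zero]) ?_)
      rw [h0, map_zero] at h
      rw [map_zero, normSq_eq_zero.1 h.symm]
    · exact Or.inl (mem_cliffGroup_four_of_normSq h h0)

lemma omega_mem_quatIntSubring {a : Cliff 3} :
    omega a ∈ quatIntSubring ↔ a ∈ cliffThreeInt := by
  constructor
  · intro h
    obtain ⟨x, y, z, w, h⟩ := mem_quatIntSubring.1 h
    have hi : ∀ (n : ℤ) (x : Cliff 3), x ∈ ({1, gen 3 (0 : Fin 2), gen 3 (1 : Fin 2),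
        gen 3 (0 : Fin 2) * gen 3 (1 : Fin 2)} : Set (Cliff 3)) → (n : ℝ) • x ∈ cliffThreeInt :=
      fun n x hx => by
        rw [Int.cast_smul_eq_zsmul]
        exact Submodule.smul_mem _ n (Submodule.subset_span hx)
    have ha : a = omegaInv (quat x y z w) := by rw [← h]; exact (omega.symm_apply_apply a).symm
    rw [ha, omegaInv_apply, Algebra.algebraMap_eq_smul_one]
    exact add_mem (add_mem (add_mem (hi x _ (by simp)) (hi y _ (by simp))) (hi z _ (by simp)))
      (hi w _ (by simp))
  · intro h
    induction h using Submodule.span_induction with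
    | mem x hx =>
      rw [mem_quatIntSubring]
      rcases hx with rfl | rfl | rfl | rfl
      · exact ⟨1, 0, 0, 0, by rw [map_one]; ext <;> simp⟩
      · exact ⟨0, 1, 0, 0, by simpa using omega_gen.1⟩
      · exact ⟨0, 0, 1, 0, by simpa using omega_gen.2.1⟩
      · exact ⟨0, 0, 0, 1, by rw [omega_gen.2.2]; simp⟩
    | zero => rw [map_zero]; exact zero_mem _
    | add x y _ _ hx hy => rw [map_add]; exact add_mem hx hy
    | smul r x _ hx => rw [map_zsmul]; exact zsmul_mem hx r

lemma mem_gammaTilde {x : Cliff 4} : x ∈ gammaTilde ↔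
    x ∈ cliffGroup 4 ∧ chi1 x ∈ quatIntSubring ∧ chi2 x ∈ quatIntSubring := by
  refine and_congr_right fun _ => ⟨?_, fun ⟨h1, h2⟩ => ?_⟩
  · rintro ⟨a, ha, b, hb, rfl⟩
    rw [chi1_eps, chi2_eps]
    exact ⟨omega_mem_quatIntSubring.2 ha, omega_mem_quatIntSubring.2 hb⟩
  · obtain ⟨a, b, rfl⟩ := exists_eps x
    rw [chi1_eps] at h1
    rw [chi2_eps] at h2
    exact ⟨a, omega_mem_quatIntSubring.1 h1, b, omega_mem_quatIntSubring.1 h2, rfl⟩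

lemma mem_gammaTilde_or_eq_zero {x : Cliff 4} : x ∈ gammaTilde ∨ x = 0 ↔
    (x ∈ cliffGroup 4 ∨ x = 0) ∧ chi1 x ∈ quatIntSubring ∧ chi2 x ∈ quatIntSubring := by
  rw [mem_gammaTilde]
  constructor
  · rintro (h | rfl)
    · exact ⟨Or.inl h.1, h.2⟩
    · simp [zero_mem]
  · rintro ⟨h | h, h'⟩
    · exact Or.inl ⟨h, h'⟩
    · exact Or.inr h

/-! ### The groups `SL₊(Γ_4(ℝ))`, `SL₊(Γ̃_4(ℤ))`, `SL_2(ℍ(ℝ))` and `SL_2(ℍ(ℤ))` -/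

/-- The adjugate `(δ*, -β*; -γ*, α*)` of a matrix over a Clifford algebra. -/
def dagger {n : ℕ} (M : M2 (Cliff n)) : M2 (Cliff n) :=
  !![rev (M 1 1), -rev (M 0 1); -rev (M 1 0), rev (M 0 0)]

lemma dagger_dagger {n : ℕ} (M : M2 (Cliff n)) : dagger (dagger M) = M := by
  ext r s
  fin_cases r <;> fin_cases s <;> simp [dagger]

lemma dagger_mul {n : ℕ} (M N : M2 (Cliff n)) : dagger (M * N) = dagger N * dagger M := by
  ext r s
  fin_cases r <;> fin_cases s <;> simp [dagger, Matrix.mul_apply, Fin.sum_univ_two] <;> abel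

lemma chiTilde_apply (M : M2 (Cliff 4)) (r s : Fin 2) : chiTilde M r s = chi1 (M r s) := rfl

lemma chiTilde_dagger (M : M2 (Cliff 4)) : chiTilde (dagger M) =
    !![tau (chi2 (M 1 1)), -tau (chi2 (M 0 1)); -tau (chi2 (M 1 0)), tau (chi2 (M 0 0))] := by
  ext1 r s
  rw [chiTilde_apply]
  fin_cases r <;> fin_cases s <;> simp [dagger, ← chi1_rev]

lemma chi2_eq_of_chiTilde_dagger {M N : M2 (Cliff 4)}
    (h : chiTilde (dagger M) = chiTilde (dagger N)) (r s : Fin 2) :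
    chi2 (M r s) = chi2 (N r s) := by
  have tau_inj : Function.Injective tau := Function.LeftInverse.injective tau_tau
  rw [chiTilde_dagger, chiTilde_dagger] at h
  have h' := fun r s => congrFun (congrFun h r) s
  fin_cases r <;> fin_cases s
  · exact tau_inj (by simpa using h' 1 1)
  · exact tau_inj (by simpa using h' 0 1)
  · exact tau_inj (by simpa using h' 1 0)
  · exact tau_inj (by simpa using h' 0 0)

lemma matrix_ext_of_chiTilde {M N : M2 (Cliff 4)} (h : chiTilde M = chiTilde N)
    (h' : chiTilde (dagger M) = chiTilde (dagger N)) : M = N := by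
  ext1 r s
  exact chi_ext (congrFun (congrFun h r) s) (chi2_eq_of_chiTilde_dagger h' r s)

lemma dagger_one {n : ℕ} : dagger (1 : M2 (Cliff n)) = 1 := by
  ext r s
  fin_cases r <;> fin_cases s <;> simp [dagger]

/-- The product `M * dagger M` is fixed by `dagger`, so its image under `chiTilde` already
determines it. -/
lemma mul_dagger_eq_one_iff {M : M2 (Cliff 4)} :
    M * dagger M = 1 ↔ chiTilde M * chiTilde (dagger M) = 1 := by
  rw [← map_mul]
  refine ⟨fun h => by rw [h, map_one], fun h => ?_⟩
  apply matrix_ext_of_chiTilde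
  · rw [h, map_one]
  · rw [dagger_mul, dagger_dagger, h, dagger_one, map_one]

/-- One-sided inverses are two-sided for matrices over ℍ; the previous equivalence carries this back
to `Cliff 4`. -/
lemma dagger_mul_self {M : M2 (Cliff 4)} (h : M * dagger M = 1) : dagger M * M = 1 := by
  have h' := mul_dagger_eq_one_iff.1 h
  rw [mul_eq_one_comm] at h'
  have := mul_dagger_eq_one_iff (M := dagger M)
  rw [dagger_dagger] at this
  exact this.2 h'

lemma quatAdj_eq_smul {Q N : M2 ℍ[ℝ]} (h : Q * N = 1) : quatAdj Q = gramDet Q • N := by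
  have h' := congrArg (N * ·) (mul_quatAdj Q)
  simpa [← mul_assoc, mul_eq_one_comm.1 h] using h'

lemma gramDet_ne_zero {Q N : M2 ℍ[ℝ]} (h : Q * N = 1) : gramDet Q ≠ 0 := by
  have h' := gramDet_mul Q N
  rw [h, gramDet_one] at h'
  exact left_ne_zero_of_mul (h' ▸ one_ne_zero)

/-- With g = `gramDet Q`, the adjugate is gN, so the norm formulas give g²x = gx for x = |d|², |b|²,
|c|². If g ≠ 1, these entries vanish, which forces g = 0 and contradicts invertibility. -/
lemma gramDet_eq_one_of_normSq {Q N : M2 ℍ[ℝ]} (h : Q * N = 1)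
    (h00 : normSq (N 0 0) = normSq (Q 1 1)) (h01 : normSq (N 0 1) = normSq (Q 0 1))
    (h10 : normSq (N 1 0) = normSq (Q 1 0)) :
    gramDet Q = 1 := by
  have hg := gramDet_ne_zero h
  by_contra hne
  obtain ⟨k00, k01, k10, -⟩ := normSq_quatAdj Q
  simp only [quatAdj_eq_smul h, Matrix.smul_apply, normSq_smul, h00, h01, h10] at k00 k01 k10
  have key : ∀ x : ℝ, gramDet Q ^ 2 * x = x * gramDet Q → x = 0 := fun x hx => by
    have : gramDet Q * (gramDet Q - 1) * x = 0 := by linear_combination hx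
    exact (mul_eq_zero.1 this).resolve_left (mul_ne_zero hg (sub_ne_zero.2 hne))
  refine hg ?_
  rw [gramDet, gram, key _ k00, key _ k01, normSq_eq_zero.1 (key _ k10)]
  simp

lemma vahlenDet_eq {n : ℕ} (M : M2 (Cliff n)) : (M * dagger M) 0 0 = vahlenDet M := by
  simp [Matrix.mul_apply, Fin.sum_univ_two, dagger, vahlenDet, sub_eq_add_neg]

/-- The vector conditions become the vanishing of off-diagonal entries: those on αβ* and γδ* come
from `M * dagger M`, those on γ*α and δ*β from `dagger M * M`. The equal-norm condition on the
entries is traded for `gramDet = 1`. -/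
lemma mem_SLPlus_four {M : M2 (Cliff 4)} :
    M ∈ SLPlus 4 ↔ M * dagger M = 1 ∧ gramDet (chiTilde M) = 1 := by
  constructor
  · rintro ⟨⟨hM, -, h1, h2, -, -⟩, hdet⟩
    rw [mem_vectors_four, rev_mul, rev_rev] at h1 h2
    have hd : rev (vahlenDet M) = 1 := by rw [hdet, rev_one]
    have h : M * dagger M = 1 := by
      ext r s
      fin_cases r <;> fin_cases s
      · exact (vahlenDet_eq M).trans hdet
      · simp [Matrix.mul_apply, Fin.sum_univ_two, dagger, h1]
      · simp [Matrix.mul_apply, Fin.sum_univ_two, dagger, h2]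
      -- The lower right entry is the reversal of the pseudo-determinant.
      · rw [vahlenDet, rev, map_sub, ← rev, ← rev, rev_mul, rev_mul, rev_rev, rev_rev] at hd
        simpa [Matrix.mul_apply, Fin.sum_univ_two, dagger, sub_eq_add_neg, add_comm] using hd
    refine ⟨h, gramDet_eq_one_of_normSq (mul_dagger_eq_one_iff.1 h) ?_ ?_ ?_⟩ <;>
      rw [chiTilde_dagger] <;>
      simp [normSq_tau, chiTilde_apply,
        fun r s => mem_cliffGroup_four_or_eq_zero.1 (hM r s)]
  · rintro ⟨h, hg⟩
    have h' := dagger_mul_self h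
    have hdet : vahlenDet M = 1 := by rw [← vahlenDet_eq, h]; rfl
    have hN := quatAdj_eq_smul (mul_dagger_eq_one_iff.1 h)
    obtain ⟨k00, k01, k10, k11⟩ := normSq_quatAdj (chiTilde M)
    rw [hN, hg, one_smul, chiTilde_dagger] at k00 k01 k10 k11
    simp only [Matrix.of_apply, Matrix.cons_val_zero, Matrix.cons_val_one, Matrix.cons_val',
      Matrix.cons_val_fin_one, normSq_neg, normSq_tau, mul_one, chiTilde_apply] at k00 k01 k10 k11
    have e01 := congrFun (congrFun h 0) 1
    have e10 := congrFun (congrFun h 1) 0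
    have f01 := congrFun (congrFun h' 0) 1
    have f10 := congrFun (congrFun h' 1) 0
    simp [Matrix.mul_apply, Fin.sum_univ_two, dagger] at e01 e10 f01 f10
    refine ⟨⟨fun r s => ?_, by rw [hdet]; exact one_ne_zero, ?_, ?_, ?_, ?_⟩, hdet⟩
    · rw [mem_cliffGroup_four_or_eq_zero]
      fin_cases r <;> fin_cases s
      exacts [k11.symm, k01.symm, k10.symm, k00.symm]
    · rw [mem_vectors_four, rev_mul, rev_rev]
      exact (neg_add_eq_zero.1 e01).symm
    · rw [mem_vectors_four, rev_mul, rev_rev]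
      exact (add_neg_eq_zero.1 e10).symm
    · rw [mem_vectors_four, rev_mul, rev_rev]
      exact (neg_add_eq_zero.1 f10).symm
    · rw [mem_vectors_four, rev_mul, rev_rev]
      exact (add_neg_eq_zero.1 f01).symm

/-- The second components of `M` are thus integral polynomials in the first ones, which yields both
injectivity and integrality. -/
lemma chiTilde_dagger_eq_quatAdj {M : M2 (Cliff 4)} (hM : M ∈ SLPlus 4) :
    chiTilde (dagger M) = quatAdj (chiTilde M) := by
  obtain ⟨h, hg⟩ := mem_SLPlus_four.1 hM
  rw [quatAdj_eq_smul (mul_dagger_eq_one_iff.1 h), hg, one_smul]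

lemma mem_SL2Real {Q : M2 ℍ[ℝ]} : Q ∈ SL2Real ↔ gramDet Q = 1 := dieudonne_eq_one_iff Q

lemma mem_SL2Int {Q : M2 ℍ[ℝ]} :
    Q ∈ SL2Int ↔ (∀ r s, Q r s ∈ quatIntSubring) ∧ gramDet Q = 1 :=
  and_congr_right fun _ => dieudonne_eq_one_iff Q

lemma mem_SLPlusTilde {M : M2 (Cliff 4)} :
    M ∈ SLPlusTilde ↔ M ∈ SLPlus 4 ∧ chiTilde M ∈ SL2Int := by
  constructor
  · rintro ⟨hM, hdet, h1, h2, h3, h4⟩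
    have h : M ∈ SLPlus 4 :=
      ⟨⟨fun r s => (mem_gammaTilde_or_eq_zero.1 (hM r s)).1, by rw [hdet]; exact one_ne_zero,
        mem_vectors_four.2 (mem_intVectors_four.1 h1).1,
        mem_vectors_four.2 (mem_intVectors_four.1 h2).1,
        mem_vectors_four.2 (mem_intVectors_four.1 h3).1,
        mem_vectors_four.2 (mem_intVectors_four.1 h4).1⟩, hdet⟩
    exact ⟨h, mem_SL2Int.2 ⟨fun r s => (mem_gammaTilde_or_eq_zero.1 (hM r s)).2.1,
      (mem_SLPlus_four.1 h).2⟩⟩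
  · rintro ⟨hM, hQ⟩
    have hi := (mem_SL2Int.1 hQ).1
    -- Integrality passes from the `chi1`-components to the `chi2`-components, because the latter
    -- are, up to sign and `tau`, the entries of the adjugate.
    have hN := quatAdj_mem_quatIntSubring hi
    rw [← chiTilde_dagger_eq_quatAdj hM, chiTilde_dagger] at hN
    have hn : ∀ {q : ℍ[ℝ]}, tau q ∈ quatIntSubring → q ∈ quatIntSubring := fun {q} h =>
      tau_tau q ▸ tau_mem_quatIntSubring h
    have hn' : ∀ {q : ℍ[ℝ]}, -tau q ∈ quatIntSubring → q ∈ quatIntSubring := fun {q} h =>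
      hn (neg_mem_iff.1 h)
    have h2 : ∀ r s, chi2 (M r s) ∈ quatIntSubring := fun r s => by
      fin_cases r <;> fin_cases s
      exacts [hn (hN 1 1), hn' (hN 0 1), hn' (hN 1 0), hn (hN 0 0)]
    obtain ⟨⟨hM, -, k1, k2, k3, k4⟩, hdet⟩ := hM
    have h3 : ∀ r s, chi1 (rev (M r s)) ∈ quatIntSubring := fun r s => by
      rw [chi1_rev]; exact tau_mem_quatIntSubring (h2 r s)
    refine ⟨fun r s => mem_gammaTilde_or_eq_zero.2 ⟨hM r s, hi r s, h2 r s⟩, hdet, ?_, ?_, ?_, ?_⟩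
    all_goals
      refine mem_intVectors_four.2 ⟨mem_vectors_four.1 (by assumption), ?_⟩
      rw [map_mul]
    exacts [mul_mem (hi _ _) (h3 _ _), mul_mem (hi _ _) (h3 _ _), mul_mem (h3 _ _) (hi _ _),
      mul_mem (h3 _ _) (hi _ _)]

/-- The group `SL_2(ℍ(ℝ))`. -/
def SL2RealGroup : Subgroup (M2 ℍ[ℝ])ˣ where
  carrier := {u | u.val ∈ SL2Real}
  one_mem' := mem_SL2Real.2 gramDet_one
  mul_mem' := by
    intro u v hu hv
    have hu' := mem_SL2Real.1 hu
    have hv' := mem_SL2Real.1 hv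
    exact mem_SL2Real.2 (by rw [Units.val_mul, gramDet_mul, hu', hv', one_mul])
  inv_mem' := by
    intro u hu
    have h := gramDet_mul u.val u⁻¹.val
    rw [u.mul_inv, gramDet_one, mem_SL2Real.1 hu, one_mul] at h
    exact mem_SL2Real.2 h.symm

lemma mem_SL2RealGroup {u : (M2 ℍ[ℝ])ˣ} : u ∈ SL2RealGroup ↔ u.val ∈ SL2Real := Iff.rfl

/-- The group `SL_2(ℍ(ℤ))`. -/
def SL2IntGroup : Subgroup (M2 ℍ[ℝ])ˣ where
  carrier := {u | u.val ∈ SL2Int}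
  one_mem' := mem_SL2Int.2 ⟨fun r s => by
    rw [Units.val_one, Matrix.one_apply]
    split_ifs
    exacts [one_mem _, zero_mem _], gramDet_one⟩
  mul_mem' := by
    intro u v hu hv
    have hu' := mem_SL2Int.1 hu
    have hv' := mem_SL2Int.1 hv
    refine mem_SL2Int.2 ⟨fun r s => ?_, ?_⟩
    · rw [Units.val_mul, Matrix.mul_apply]
      exact sum_mem fun i _ => mul_mem (hu'.1 r i) (hv'.1 i s)
    · rw [Units.val_mul, gramDet_mul, hu'.2, hv'.2, one_mul]
  inv_mem' := by
    intro u hu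
    have hu' := mem_SL2Int.1 hu
    refine mem_SL2Int.2 ⟨fun r s => ?_, ?_⟩
    · have h := quatAdj_mem_quatIntSubring hu'.1 r s
      rwa [quatAdj_eq_smul u.mul_inv, hu'.2, one_smul] at h
    · exact mem_SL2Real.1 (SL2RealGroup.inv_mem (x := u) (mem_SL2Real.2 hu'.2))

lemma mem_SL2IntGroup {u : (M2 ℍ[ℝ])ˣ} : u ∈ SL2IntGroup ↔ u.val ∈ SL2Int := Iff.rfl

/-- The group `SL₊(Γ_4(ℝ))`. -/
def SLPlusGroup : Subgroup (M2 (Cliff 4))ˣ where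
  carrier := {u | u.val ∈ SLPlus 4}
  one_mem' := mem_SLPlus_four.2
    ⟨by rw [Units.val_one, dagger_one, one_mul], by rw [Units.val_one, map_one, gramDet_one]⟩
  mul_mem' := by
    intro u v hu hv
    obtain ⟨h1, h2⟩ := mem_SLPlus_four.1 hu
    obtain ⟨h3, h4⟩ := mem_SLPlus_four.1 hv
    refine mem_SLPlus_four.2 ⟨?_, ?_⟩
    · rw [Units.val_mul, dagger_mul, mul_assoc, ← mul_assoc v.val, h3, one_mul, h1]
    · rw [Units.val_mul, map_mul, gramDet_mul, h2, h4, one_mul]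
  inv_mem' := by
    intro u hu
    obtain ⟨h1, h2⟩ := mem_SLPlus_four.1 hu
    have hi : u⁻¹.val = dagger u.val := Units.inv_eq_of_mul_eq_one_right h1
    refine mem_SLPlus_four.2 ⟨?_, ?_⟩
    · rw [hi, dagger_dagger, dagger_mul_self h1]
    · have h := gramDet_mul (chiTilde u.val) (chiTilde u⁻¹.val)
      rw [← map_mul, u.mul_inv, map_one, gramDet_one, h2, one_mul] at h
      exact h.symm

lemma mem_SLPlusGroup {u : (M2 (Cliff 4))ˣ} : u ∈ SLPlusGroup ↔ u.val ∈ SLPlus 4 := Iff.rfl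

/-- The homomorphism induced by `χ̃` on invertible matrices. -/
def chiUnits : (M2 (Cliff 4))ˣ →* (M2 ℍ[ℝ])ˣ := Units.map (chiTilde : M2 (Cliff 4) →* M2 ℍ[ℝ])

lemma val_chiUnits (u : (M2 (Cliff 4))ˣ) : (chiUnits u).val = chiTilde u.val := rfl

/-- The group `SL₊(Γ̃_4(ℤ))`. -/
def SLPlusTildeGroup : Subgroup (M2 (Cliff 4))ˣ := SLPlusGroup ⊓ SL2IntGroup.comap chiUnits

lemma mem_SLPlusTildeGroup {u : (M2 (Cliff 4))ˣ} :
    u ∈ SLPlusTildeGroup ↔ u.val ∈ SLPlusTilde := mem_SLPlusTilde.symm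

lemma SL2IntGroup_le : SL2IntGroup ≤ SL2RealGroup := fun _ h => h.2

lemma chiUnits_mem {u : (M2 (Cliff 4))ˣ} (hu : u ∈ SLPlusGroup) : chiUnits u ∈ SL2RealGroup :=
  mem_SL2Real.2 (mem_SLPlus_four.1 hu).2

lemma isUnit_of_mem_SL2Real {Q : M2 ℍ[ℝ]} (hQ : Q ∈ SL2Real) :
    ∃ u : (M2 ℍ[ℝ])ˣ, u.val = Q := by
  have h := mul_quatAdj Q
  rw [mem_SL2Real.1 hQ, one_smul] at h
  exact ⟨⟨Q, quatAdj Q, h, mul_eq_one_comm.1 h⟩, rfl⟩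

lemma isUnit_of_mem_SLPlus {M : M2 (Cliff 4)} (hM : M ∈ SLPlus 4) :
    ∃ u : (M2 (Cliff 4))ˣ, u.val = M := by
  have h := (mem_SLPlus_four.1 hM).1
  exact ⟨⟨M, dagger M, h, dagger_mul_self h⟩, rfl⟩

/-- A set of matrices is a group under multiplication once it consists of units and these form a
subgroup; this lemma passes between the two views. -/
lemma val_image_eq {R : Type} [Ring R] {S : Set R} {G : Subgroup Rˣ}
    (hG : ∀ u : Rˣ, u ∈ G ↔ u.val ∈ S) (hS : ∀ x ∈ S, ∃ u : Rˣ, u.val = x) :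
    Units.val '' (G : Set Rˣ) = S := by
  ext x
  constructor
  · rintro ⟨u, hu, rfl⟩
    exact (hG u).1 hu
  · intro hx
    obtain ⟨u, rfl⟩ := hS x hx
    exact ⟨u, (hG u).2 hx, rfl⟩

lemma chiUnits_injOn {u v : (M2 (Cliff 4))ˣ} (hu : u ∈ SLPlusGroup) (hv : v ∈ SLPlusGroup)
    (h : chiUnits u = chiUnits v) : u = v := by
  have h' : chiTilde u.val = chiTilde v.val := congrArg Units.val h
  refine Units.ext (matrix_ext_of_chiTilde h' ?_)
  rw [chiTilde_dagger_eq_quatAdj hu, chiTilde_dagger_eq_quatAdj hv, h']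

lemma exists_chiUnits_eq {v : (M2 ℍ[ℝ])ˣ} (hv : v ∈ SL2RealGroup) :
    ∃ u ∈ SLPlusGroup, chiUnits u = v := by
  set N := v⁻¹.val with hN
  -- The second components solve `chiTilde (dagger M) = N` for `N` the inverse of `v`, using that
  -- `tau` is an involution.
  set M : M2 (Cliff 4) :=
    !![ofPair (v.val 0 0) (tau (N 1 1)), ofPair (v.val 0 1) (-tau (N 0 1));
      ofPair (v.val 1 0) (-tau (N 1 0)), ofPair (v.val 1 1) (tau (N 0 0))] with hM
  have h1 : chiTilde M = v.val := by
    ext1 r s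
    rw [chiTilde_apply]
    fin_cases r <;> fin_cases s <;> simp [hM]
  have h2 : chiTilde (dagger M) = N := by
    rw [chiTilde_dagger]
    ext1 r s
    fin_cases r <;> fin_cases s <;> simp [hM, tau_tau, tau_neg]
  have hS : M ∈ SLPlus 4 := mem_SLPlus_four.2
    ⟨mul_dagger_eq_one_iff.2 (by rw [h1, h2, hN, v.mul_inv]), by rw [h1]; exact mem_SL2Real.1 hv⟩
  obtain ⟨u, hu⟩ := isUnit_of_mem_SLPlus hS
  exact ⟨u, mem_SLPlusGroup.2 (hu ▸ hS), Units.ext (by rw [val_chiUnits, hu, h1])⟩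

/-- The isomorphism `χ : SL₊(Γ_4(ℝ)) ≃ SL_2(ℍ(ℝ))`. -/
def chiEquiv : SLPlusGroup ≃* SL2RealGroup :=
  MulEquiv.ofBijective
    ((chiUnits.comp SLPlusGroup.subtype).codRestrict SL2RealGroup fun u => chiUnits_mem u.2)
    ⟨fun u v h => Subtype.ext (chiUnits_injOn u.2 v.2 (congrArg Subtype.val h)), fun v => by
      obtain ⟨u, hu, h⟩ := exists_chiUnits_eq v.2
      exact ⟨⟨u, hu⟩, Subtype.ext h⟩⟩

/-- The isomorphism `SL₊(Γ̃_4(ℤ)) ≃ SL_2(ℍ(ℤ))` obtained by restricting `χ`. -/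
def chiIntEquiv : SLPlusTildeGroup ≃* SL2IntGroup :=
  MulEquiv.ofBijective
    ((chiUnits.comp SLPlusTildeGroup.subtype).codRestrict SL2IntGroup fun u => u.2.2)
    ⟨fun u v h => Subtype.ext (chiUnits_injOn u.2.1 v.2.1 (congrArg Subtype.val h)), fun v => by
      obtain ⟨u, hu, h⟩ := exists_chiUnits_eq (SL2IntGroup_le v.2)
      exact ⟨⟨u, hu, show chiUnits u ∈ SL2IntGroup from h ▸ v.2⟩, Subtype.ext h⟩⟩

end CliffordSL

end

theorem mainTheorem4 :
    ∃ (G GZ : Subgroup (CliffordSL.M2 (CliffordSL.Cliff 4))ˣ)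
      (H HZ : Subgroup (CliffordSL.M2 (Quaternion ℝ))ˣ),
      Units.val '' (G : Set (CliffordSL.M2 (CliffordSL.Cliff 4))ˣ) = CliffordSL.SLPlus 4 ∧
      Units.val '' (GZ : Set (CliffordSL.M2 (CliffordSL.Cliff 4))ˣ) = CliffordSL.SLPlusTilde ∧
      Units.val '' (H : Set (CliffordSL.M2 (Quaternion ℝ))ˣ) = CliffordSL.SL2Real ∧
      Units.val '' (HZ : Set (CliffordSL.M2 (Quaternion ℝ))ˣ) = CliffordSL.SL2Int ∧
      ∃ (hG : GZ ≤ G) (hH : HZ ≤ H) (χ : G ≃* H) (χZ : GZ ≃* HZ),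
        (∀ M : G, (χ M).1.val = CliffordSL.chiTilde M.1.val) ∧
        ∀ M : GZ, Subgroup.inclusion hH (χZ M) = χ (Subgroup.inclusion hG M) := by
  open CliffordSL in
  exact ⟨SLPlusGroup, SLPlusTildeGroup, SL2RealGroup, SL2IntGroup,
    val_image_eq (fun _ => mem_SLPlusGroup) fun _ => isUnit_of_mem_SLPlus,
    val_image_eq (fun _ => mem_SLPlusTildeGroup) fun _ hM =>
      isUnit_of_mem_SLPlus (mem_SLPlusTilde.1 hM).1,
    val_image_eq (fun _ => mem_SL2RealGroup) fun _ => isUnit_of_mem_SL2Real,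
    val_image_eq (fun _ => mem_SL2IntGroup) fun _ hQ => isUnit_of_mem_SL2Real hQ.2,
    inf_le_left, SL2IntGroup_le, chiEquiv, chiIntEquiv, fun _ => rfl, fun _ => rfl⟩
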